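/- Let $\Lambda$ be the set of pure $\lambda$-terms (up to renaming of bound variables), with application written $(t)u$. A $\lambda$-term is \emph{normalizable} if it $\beta$-reduces to a $\beta$-normal term. Let $L$ be a second-order language (function symbols and relation symbols of all arities $n\ge 0$) and let $E$ be a set of equations $u=v$ between terms of $L$. The \emph{types} (of the system $\mathcal{AF}2$ given by $L$ and $E$) are the second-order formulas of $L$, built from atomic formulas $P(t_1,\dots,t_n)$ ($P$ an $n$-ary relation symbol or $n$-ary relation variable) with $\to$, $\forall x$ ($x$ an individual variable) and $\forall X$ ($X$ a relation variable of any arity). The classes $\forall_2^+$ and $\forall_2^-$ of types are defined simultaneously by induction: atomic formulas are in both; if $B$ is $\forall_2^-$ (resp. $\forall_2^+$) and $A$ is $\forall_2^+$ (resp. $\forall_2^-$), then $B\to A$ is $\forall_2^+$ (resp. $\forall_2^-$); if $A$ is $\forall_2^+$, then $\forall xA$ and $\forall XA$ are $\forall_2^+$; if $A$ is $\forall_2^-$, then $\forall xA$ is $\forall_2^-$, and so is $\forall XA$ provided that $X$ does not occur free in $A$. A set $G\subseteq\Lambda$ is \emph{saturated} if $u\in G$ and $t\simeq_{\beta\eta}u$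 imply $t\in G$; for $G,G'\subseteq\Lambda$ put $G\to G'=\{u\in\Lambda : (u)t\in G' \text{ for all } t\in G\}$. A set $R$ of saturated sets is \emph{adequate} if it is closed under $\to$ and under arbitrary intersections (so that $\Lambda\in R$, as the empty intersection). A \emph{$\Lambda_{\beta\eta}$-model} $M$ for $L$ consists of a nonempty set $|M|$, an adequate set $R$, a function $f_M:|M|^n\to|M|$ for each $n$-ary function symbol $f$, and a function $P_M:|M|^n\to R$ for each $n$-ary relation symbol $P$. An interpretation $I$ assigns to each individual variable an element of $|M|$ and to each $n$-ary relation variable a function $|M|^n\to R$. Terms are evaluated in $|M|$ as usual, and the value $|F|_{M,I}\in R$ of a formula is defined by $|P(t^1,\dots,t^n)|_{M,I}=P_M(t^1_{M,I},\dots,t^n_{M,I})$ (with $I(P)$ in place of $P_M$ if $P$ is a variable), $|G\to H|_{M,I}=|G|_{M,I}\to|H|_{M,I}$, $|\forall xG|_{M,I}=\bigcap_{a\in|M|}|G|_{M,I[x\leftarrow a]}$ and $|\forall XG|_{M,I}=\bigcap_{\Phi:|M|^n\to R}|G|_{M,I[X\leftarrow\Phi]}$. The value of a closed formula does not depend on $I$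 and is written $|F|_M$. $M$ is a \emph{model of $E$} if $u_{M,I}=v_{M,I}$ for every equation $u=v$ of $E$ and every interpretation $I$. For a closed type $A$ let $|A|_{\beta\eta}$ be the intersection of the sets $|A|_M$ over all $\Lambda_{\beta\eta}$-models $M$ of $E$. \textbf{Corollary 3.4.} Let $A$ be a closed $\forall_2^+$ type and $t$ a $\lambda$-term. If $t\in|A|_{\beta\eta}$, then $t$ is normalizable and $t$ is $\beta$-equivalent to a closed $\lambda$-term. -/

import Mathlib

universe u v w

namespace AF2

/-! ### Pure lambda-calculus (terms modulo alpha, in de Bruijn form) -/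

/-- Pure lambda-terms. In `var n`, the index `n` counts the abstractions to cross before
reaching the binder; the indices pointing beyond all binders are the free variables. -/
inductive Lam : Type
  | var (n : ℕ) : Lam
  | app (t s : Lam) : Lam
  | lam (t : Lam) : Lam

namespace Lam

/-- Lifting of a renaming under a binder. -/
def upRen (ρ : ℕ → ℕ) : ℕ → ℕ
  | 0 => 0
  | n + 1 => ρ n + 1

/-- Renaming of the free variables. -/
def rename : (ℕ → ℕ) → Lam → Lam
  | ρ, var n => var (ρ n)
  | ρ, app t s => app (rename ρ t) (rename ρ s)
  | ρ, lam t => lam (rename (upRen ρ) t)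

/-- Lifting of a substitution under a binder. -/
def upSubst (σ : ℕ → Lam) : ℕ → Lam
  | 0 => var 0
  | n + 1 => rename Nat.succ (σ n)

/-- Simultaneous capture-avoiding substitution for the free variables. -/
def subst : (ℕ → Lam) → Lam → Lam
  | σ, var n => σ n
  | σ, app t s => app (subst σ t) (subst σ s)
  | σ, lam t => lam (subst (upSubst σ) t)

/-- The substitution that replaces variable `0` by `s` and lowers the other variables. -/
def single (s : Lam) : ℕ → Lam
  | 0 => s
  | n + 1 => var n

/-- One step of beta-reduction, in an arbitrary context. -/
inductive BetaStep : Lam → Lam → Prop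
  | beta (t s : Lam) : BetaStep (app (lam t) s) (subst (single s) t)
  | appL {t t' : Lam} (s : Lam) : BetaStep t t' → BetaStep (app t s) (app t' s)
  | appR (t : Lam) {s s' : Lam} : BetaStep s s' → BetaStep (app t s) (app t s')
  | lam {t t' : Lam} : BetaStep t t' → BetaStep (lam t) (lam t')

/-- One step of eta-reduction `λx.(t)x → t` (with `x` not free in `t`), in an arbitrary
context. -/
inductive EtaStep : Lam → Lam → Prop
  | eta (t : Lam) : EtaStep (lam (app (rename Nat.succ t) (var 0))) t
  | appL {t t' : Lam} (s : Lam) : EtaStep t t' → EtaStep (app t s) (app t' s)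
  | appR (t : Lam) {s s' : Lam} : EtaStep s s' → EtaStep (app t s) (app t s')
  | lam {t t' : Lam} : EtaStep t t' → EtaStep (lam t) (lam t')

/-- Beta-reduction. -/
def BetaRed : Lam → Lam → Prop := Relation.ReflTransGen BetaStep

/-- Beta-equivalence. -/
def BetaEq : Lam → Lam → Prop := Relation.EqvGen BetaStep

/-- Beta-eta-equivalence. -/
def BetaEtaEq : Lam → Lam → Prop :=
  Relation.EqvGen (fun t s => BetaStep t s ∨ EtaStep t s)

/-- A term is normal if it has no beta-redex. -/
def IsNormal (t : Lam) : Prop := ∀ s, ¬ BetaStep t s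

/-- A term is normalizable if it beta-reduces to a normal term. -/
def Normalizable (t : Lam) : Prop := ∃ s, BetaRed t s ∧ IsNormal s

/-- The set of free variables. -/
def freeVars : Lam → Set ℕ
  | var n => {n}
  | app t s => freeVars t ∪ freeVars s
  | lam t => {n | n + 1 ∈ freeVars t}

/-- A term is closed if it has no free variable. -/
def Closed (t : Lam) : Prop := freeVars t = ∅

end Lam

/-! ### Second-order formulas (the types) -/

/-- Relation variables: the pair `(n, i)` is the `i`-th relation variable of arity `n`. -/
abbrev RelVar : Type := ℕ × ℕ

/-- The formulas of the second-order language with the function and relation symbols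
of `L`. The individual variables are indexed by `ℕ`. -/
inductive Formula (L : FirstOrder.Language.{u, v}) : Type (max u v)
  | relVar (X : RelVar) (ts : Fin X.1 → L.Term ℕ) : Formula L
  | relSym {n : ℕ} (P : L.Relations n) (ts : Fin n → L.Term ℕ) : Formula L
  | imp (A B : Formula L) : Formula L
  | allInd (x : ℕ) (A : Formula L) : Formula L
  | allRel (X : RelVar) (A : Formula L) : Formula L

namespace Formula

variable {L : FirstOrder.Language.{u, v}}

/-- The free individual variables. -/
def freeInd : Formula L → Set ℕ
  | relVar _ ts => ⋃ i, ((ts i).varFinset : Set ℕ)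
  | relSym _ ts => ⋃ i, ((ts i).varFinset : Set ℕ)
  | imp A B => freeInd A ∪ freeInd B
  | allInd x A => freeInd A \ {x}
  | allRel _ A => freeInd A

/-- The free relation variables. -/
def freeRel : Formula L → Set RelVar
  | relVar X _ => {X}
  | relSym _ _ => ∅
  | imp A B => freeRel A ∪ freeRel B
  | allInd _ A => freeRel A
  | allRel X A => freeRel A \ {X}

/-- A formula is closed if it has no free variable of either kind. -/
def Closed (A : Formula L) : Prop := freeInd A = ∅ ∧ freeRel A = ∅

mutual

/-- The types with positive (second-order) quantifiers. -/
inductive IsPos : Formula L → Prop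
  | relVar (X : RelVar) (ts : Fin X.1 → L.Term ℕ) : IsPos (relVar X ts)
  | relSym {n : ℕ} (P : L.Relations n) (ts : Fin n → L.Term ℕ) : IsPos (relSym P ts)
  | imp {B A : Formula L} : IsNeg B → IsPos A → IsPos (imp B A)
  | allInd (x : ℕ) {A : Formula L} : IsPos A → IsPos (allInd x A)
  | allRel (X : RelVar) {A : Formula L} : IsPos A → IsPos (allRel X A)

/-- The types with negative (second-order) quantifiers. A relation variable may be
quantified here only if it does not occur in the body (freely: formulas are considered up
to the names of bound variables). -/
inductive IsNeg : Formula L → Prop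
  | relVar (X : RelVar) (ts : Fin X.1 → L.Term ℕ) : IsNeg (relVar X ts)
  | relSym {n : ℕ} (P : L.Relations n) (ts : Fin n → L.Term ℕ) : IsNeg (relSym P ts)
  | imp {B A : Formula L} : IsPos B → IsNeg A → IsNeg (imp B A)
  | allInd (x : ℕ) {A : Formula L} : IsNeg A → IsNeg (allInd x A)
  | allRel (X : RelVar) {A : Formula L} : X ∉ freeRel A → IsNeg A → IsNeg (allRel X A)

end

end Formula

/-! ### Beta-eta-models -/

/-- `G` is saturated for beta-eta-equivalence. -/
def Saturated (G : Set Lam) : Prop :=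
  ∀ t s : Lam, s ∈ G → Lam.BetaEtaEq t s → t ∈ G

/-- The set `G → G'` of the terms `s` with `(s)t ∈ G'` for all `t ∈ G`. -/
def arrow (G G' : Set Lam) : Set Lam := {s | ∀ t ∈ G, Lam.app s t ∈ G'}

/-- An adequate set of saturated sets: closed under arrows and arbitrary intersections
(the empty intersection being the set of all terms). -/
structure Adequate (R : Set (Set Lam)) : Prop where
  saturated : ∀ G ∈ R, Saturated G
  arrow_mem : ∀ G ∈ R, ∀ G' ∈ R, arrow G G' ∈ R
  sInter_mem : ∀ σ : Set (Set Lam), σ ⊆ R → ⋂₀ σ ∈ R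

/-- A beta-eta-model for the language `L`. -/
structure Model (L : FirstOrder.Language.{u, v}) where
  /-- The base. -/
  base : Type w
  base_nonempty : Nonempty base
  /-- The set of truth values. -/
  truth : Set (Set Lam)
  adequate : Adequate truth
  /-- Interpretation of the function symbols. -/
  fn : ∀ {n : ℕ}, L.Functions n → (Fin n → base) → base
  /-- Interpretation of the relation symbols. -/
  rel : ∀ {n : ℕ}, L.Relations n → (Fin n → base) → truth

namespace Model

variable {L : FirstOrder.Language.{u, v}}

/-- The interpretations of the variables in a model. -/
structure Interp (M : Model.{u, v, w} L) where
  ind : ℕ → M.base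
  rel : ∀ X : RelVar, (Fin X.1 → M.base) → M.truth

/-- The interpretation `I[x ← a]`. -/
def Interp.setInd {M : Model.{u, v, w} L} (I : M.Interp) (x : ℕ) (a : M.base) : M.Interp :=
  ⟨Function.update I.ind x a, I.rel⟩

/-- The interpretation `I[X ← Φ]`. -/
def Interp.setRel {M : Model.{u, v, w} L} (I : M.Interp) (X : RelVar)
    (Φ : (Fin X.1 → M.base) → M.truth) : M.Interp :=
  ⟨I.ind, Function.update I.rel X Φ⟩

/-- The value of a term of `L`. -/
def termValue (M : Model.{u, v, w} L) (I : M.Interp) : L.Term ℕ → M.base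
  | .var x => I.ind x
  | .func f ts => M.fn f (fun i => termValue M I (ts i))

/-- The value of a formula, a set of lambda-terms. -/
def value (M : Model.{u, v, w} L) : M.Interp → Formula L → Set Lam
  | I, .relVar X ts => I.rel X (fun i => M.termValue I (ts i))
  | I, .relSym P ts => M.rel P (fun i => M.termValue I (ts i))
  | I, .imp A B => arrow (value M I A) (value M I B)
  | I, .allInd x A => ⋂ a : M.base, value M (I.setInd x a) A
  | I, .allRel X A => ⋂ Φ : (Fin X.1 → M.base) → M.truth, value M (I.setRel X Φ) A

/-- The value of a formula is a truth value of the model. -/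
theorem value_mem (M : Model.{u, v, w} L) (A : Formula L) :
    ∀ I : M.Interp, M.value I A ∈ M.truth := by
  induction A with
  | relVar X ts => intro I; exact (I.rel X _).2
  | relSym P ts => intro I; exact (M.rel P _).2
  | imp A B ihA ihB => intro I; exact M.adequate.arrow_mem _ (ihA I) _ (ihB I)
  | allInd x A ih =>
    intro I
    refine M.adequate.sInter_mem _ ?_
    rintro _ ⟨a, rfl⟩
    exact ih _
  | allRel X A ih =>
    intro I
    refine M.adequate.sInter_mem _ ?_
    rintro _ ⟨Φ, rfl⟩
    exact ih _

/-- `M` is a model of the set `E` of equations (the pair `e` standing for the equation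
`e.1 = e.2`): both sides have the same value, whatever the values of the variables. -/
def Satisfies (M : Model.{u, v, w} L) (E : Set (L.Term ℕ × L.Term ℕ)) : Prop :=
  ∀ e ∈ E, ∀ I : M.Interp, M.termValue I e.1 = M.termValue I e.2

end Model

/-- The set `|A|_{βη}`: the intersection of the values of `A` in all the beta-eta-models
of `E`. It is used for closed `A` only, whose value does not depend on the interpretation of
the variables. -/
def betaEtaValue {L : FirstOrder.Language.{u, v}} (E : Set (L.Term ℕ × L.Term ℕ))
    (A : Formula L) : Set Lam :=
  {t | ∀ M : Model.{u, v, w} L, M.Satisfies E → ∀ I : M.Interp, t ∈ M.value I A}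

end AF2

namespace AF2

namespace Lam

open Relation

/-! ### Renaming and substitution -/

-- A single model suffices. Its base is one point, so every equation holds; its truth values are all
-- saturated sets; and every relation symbol is read as `N = normalizingIn V`, with `V` a cofinite
-- set of variables. With the free relation variables read as `N` too, an induction on types
-- (`value_saturatedModel`) shows that a positive type has value inside `N`, while a negative one
-- contains every `(x)u₁…uₙ` with `x ∈ V` and `uᵢ ∈ N`. At a positive arrow, `t` is applied to a
-- variable of `V` not free in `t`, which `mem_normalizingIn_of_app_var` then removes. Taking for
-- `V` the complement of the free variables of `t` gives a normal form of `t` whose variables lie in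
-- `V`. They are also free in `t`, so there are none. The syntactic work is the saturation of `N`.
-- Stability under beta is confluence. Stability under eta needs that parallel eta commutes with
-- beta and preserves normal forms (`EtaPar.commute`, `EtaPar.isNormal`) and, backwards,
-- postponement of eta and normalizability of terms that eta-reduce to a normal one
-- (`EtaPar.postpone`, `EtaPar.normalizable_aux`).

theorem upRen_comp (ρ ρ' : ℕ → ℕ) : upRen (ρ' ∘ ρ) = upRen ρ' ∘ upRen ρ := by
  funext n; cases n <;> rfl

theorem rename_rename (t : Lam) (ρ ρ' : ℕ → ℕ) :
    rename ρ' (rename ρ t) = rename (ρ' ∘ ρ) t := by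
  induction t generalizing ρ ρ' with
  | var n => rfl
  | app t s iht ihs => simp [rename, iht, ihs]
  | lam t ih => simp [rename, ih, upRen_comp]

theorem rename_upRen_succ (ρ : ℕ → ℕ) (t : Lam) :
    rename (upRen ρ) (rename Nat.succ t) = rename Nat.succ (rename ρ t) := by
  rw [rename_rename, rename_rename]; rfl

theorem subst_rename (t : Lam) (ρ : ℕ → ℕ) (σ : ℕ → Lam) :
    subst σ (rename ρ t) = subst (σ ∘ ρ) t := by
  induction t generalizing ρ σ with
  | var n => rfl
  | app t s iht ihs => simp [rename, subst, iht, ihs]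
  | lam t ih =>
    have h : upSubst σ ∘ upRen ρ = upSubst (σ ∘ ρ) := by funext n; cases n <;> rfl
    simp [rename, subst, ih, h]

theorem rename_subst (t : Lam) (ρ : ℕ → ℕ) (σ : ℕ → Lam) :
    rename ρ (subst σ t) = subst (rename ρ ∘ σ) t := by
  induction t generalizing ρ σ with
  | var n => rfl
  | app t s iht ihs => simp [rename, subst, iht, ihs]
  | lam t ih =>
    have h : rename (upRen ρ) ∘ upSubst σ = upSubst (rename ρ ∘ σ) := by
      funext n
      cases n with
      | zero => rfl
      | succ n => exact rename_upRen_succ ρ (σ n)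
    simp [rename, subst, ih, h]

theorem subst_upSubst_succ (σ : ℕ → Lam) (t : Lam) :
    subst (upSubst σ) (rename Nat.succ t) = rename Nat.succ (subst σ t) := by
  rw [subst_rename, rename_subst]; rfl

theorem subst_subst (t : Lam) (σ τ : ℕ → Lam) :
    subst τ (subst σ t) = subst (subst τ ∘ σ) t := by
  induction t generalizing σ τ with
  | var n => rfl
  | app t s iht ihs => simp [subst, iht, ihs]
  | lam t ih =>
    have h : subst (upSubst τ) ∘ upSubst σ = upSubst (subst τ ∘ σ) := by
      funext n
      cases n with
      | zero => rfl
      | succ n => exact subst_upSubst_succ τ (σ n)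
    simp [subst, ih, h]

theorem subst_var (t : Lam) : subst var t = t := by
  induction t with
  | var n => rfl
  | app t s iht ihs => simp [subst, iht, ihs]
  | lam t ih =>
    have h : upSubst var = var := by funext n; cases n <;> rfl
    simp [subst, h, ih]

theorem subst_single_rename_succ (s t : Lam) : subst (single s) (rename Nat.succ t) = t := by
  rw [subst_rename]; exact subst_var t

theorem subst_single_upRen_succ (t : Lam) :
    subst (single (var 0)) (rename (upRen Nat.succ) t) = t := by
  rw [subst_rename]
  have h : single (var 0) ∘ upRen Nat.succ = var := by funext n; cases n <;> rfl
  rw [h, subst_var]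

theorem rename_subst_single (ρ : ℕ → ℕ) (t s : Lam) :
    rename ρ (subst (single s) t) = subst (single (rename ρ s)) (rename (upRen ρ) t) := by
  rw [rename_subst, subst_rename]
  congr 1; funext n; cases n <;> rfl

theorem subst_subst_single (σ : ℕ → Lam) (t s : Lam) :
    subst σ (subst (single s) t) = subst (single (subst σ s)) (subst (upSubst σ) t) := by
  rw [subst_subst, subst_subst]
  congr 1; funext n
  cases n with
  | zero => rfl
  | succ n => exact (subst_single_rename_succ _ _).symm

/-! ### Free variables -/

theorem finite_freeVars (t : Lam) : (freeVars t).Finite := by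
  induction t with
  | var n => exact Set.finite_singleton n
  | app t s iht ihs => exact iht.union ihs
  | lam t ih => exact ih.preimage Nat.succ_injective.injOn

theorem rename_congr {t : Lam} {ρ ρ' : ℕ → ℕ} (h : ∀ n ∈ freeVars t, ρ n = ρ' n) :
    rename ρ t = rename ρ' t := by
  induction t generalizing ρ ρ' with
  | var n => exact congrArg var (h n rfl)
  | app t s iht ihs =>
    exact congrArg₂ app (iht fun n hn => h n (Or.inl hn)) (ihs fun n hn => h n (Or.inr hn))
  | lam t ih =>
    refine congrArg lam (ih fun n hn => ?_)
    cases n with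
    | zero => rfl
    | succ n => exact congrArg Nat.succ (h n hn)

theorem mem_freeVars_rename {t : Lam} {ρ : ℕ → ℕ} {m : ℕ} :
    m ∈ freeVars (rename ρ t) ↔ ∃ n ∈ freeVars t, ρ n = m := by
  induction t generalizing ρ m with
  | var n => simp [rename, freeVars, eq_comm]
  | app t s iht ihs => simp [rename, freeVars, iht, ihs, or_and_right, exists_or]
  | lam t ih =>
    simp only [rename, freeVars, Set.mem_ofPred_eq, ih]
    constructor
    · rintro ⟨n, hn, h⟩
      cases n with
      | zero => cases h
      | succ n => exact ⟨n, hn, Nat.succ_injective h⟩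
    · rintro ⟨n, hn, rfl⟩
      exact ⟨n + 1, hn, rfl⟩

theorem mem_freeVars_subst {t : Lam} {σ : ℕ → Lam} {m : ℕ} :
    m ∈ freeVars (subst σ t) ↔ ∃ n ∈ freeVars t, m ∈ freeVars (σ n) := by
  induction t generalizing σ m with
  | var n => simp [subst, freeVars]
  | app t s iht ihs => simp [subst, freeVars, iht, ihs, or_and_right, exists_or]
  | lam t ih =>
    simp only [subst, freeVars, Set.mem_ofPred_eq, ih]
    constructor
    · rintro ⟨n, hn, h⟩
      cases n with
      | zero => cases h
      | succ n =>
        obtain ⟨k, hk, e⟩ := mem_freeVars_rename.1 h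
        exact ⟨n, hn, Nat.succ_injective e ▸ hk⟩
    · rintro ⟨n, hn, h⟩
      exact ⟨n + 1, hn, mem_freeVars_rename.2 ⟨m, h, rfl⟩⟩

theorem BetaStep.freeVars_subset {t s : Lam} (h : BetaStep t s) : freeVars s ⊆ freeVars t := by
  induction h with
  | beta t s =>
    intro m hm
    obtain ⟨n, hn, h⟩ := mem_freeVars_subst.1 hm
    cases n with
    | zero => exact Or.inr h
    | succ n =>
      have e : m = n := h
      exact Or.inl (e ▸ hn)
  | appL s _ ih => exact Set.union_subset_union_left _ ih
  | appR t _ ih => exact Set.union_subset_union_right _ ih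
  | lam _ ih => exact fun n hn => ih hn

theorem BetaRed.freeVars_subset {t s : Lam} (h : BetaRed t s) : freeVars s ⊆ freeVars t := by
  induction h with
  | refl => exact subset_rfl
  | tail _ h ih => exact h.freeVars_subset.trans ih

/-! ### Beta-reduction -/

theorem BetaRed.app {t t' s s' : Lam} (ht : BetaRed t t') (hs : BetaRed s s') :
    BetaRed (t.app s) (t'.app s') :=
  (ReflTransGen.lift (fun x => Lam.app x s) (fun _ _ h => BetaStep.appL s h) _ _ ht).trans
    (ReflTransGen.lift (fun x => Lam.app t' x) (fun _ _ h => BetaStep.appR t' h) _ _ hs)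

theorem BetaRed.lam {t t' : Lam} (ht : BetaRed t t') : BetaRed t.lam t'.lam :=
  ReflTransGen.lift Lam.lam (fun _ _ h => BetaStep.lam h) _ _ ht

theorem BetaStep.rename {t s : Lam} (h : BetaStep t s) (ρ : ℕ → ℕ) :
    BetaStep (t.rename ρ) (s.rename ρ) := by
  induction h generalizing ρ with
  | beta t s => rw [rename_subst_single]; exact BetaStep.beta _ _
  | appL s _ ih => exact BetaStep.appL _ (ih ρ)
  | appR t _ ih => exact BetaStep.appR _ (ih ρ)
  | lam _ ih => exact BetaStep.lam (ih _)

theorem BetaRed.rename {t s : Lam} (h : BetaRed t s) (ρ : ℕ → ℕ) :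
    BetaRed (t.rename ρ) (s.rename ρ) :=
  ReflTransGen.lift (Lam.rename ρ) (fun _ _ h => h.rename ρ) _ _ h

/-- Renaming, even when not injective, never turns a non-abstraction into an abstraction, so it
creates no redex. -/
theorem BetaStep.exists_of_rename {ρ : ℕ → ℕ} {t w : Lam} (h : BetaStep (t.rename ρ) w) :
    ∃ s, BetaStep t s ∧ w = s.rename ρ := by
  induction t generalizing ρ w with
  | var n => cases h
  | app t s iht ihs =>
    cases t with
    | var n =>
      cases h with
      | appL _ h => cases h
      | appR _ h =>
        obtain ⟨s', h', rfl⟩ := ihs h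
        exact ⟨_, BetaStep.appR _ h', rfl⟩
    | app t₁ t₂ =>
      cases h with
      | appL _ h =>
        obtain ⟨s', h', rfl⟩ := iht h
        exact ⟨_, BetaStep.appL _ h', rfl⟩
      | appR _ h =>
        obtain ⟨s', h', rfl⟩ := ihs h
        exact ⟨_, BetaStep.appR _ h', rfl⟩
    | lam t₁ =>
      cases h with
      | beta => exact ⟨_, BetaStep.beta _ _, (rename_subst_single _ _ _).symm⟩
      | appL _ h =>
        obtain ⟨s', h', rfl⟩ := iht h
        exact ⟨_, BetaStep.appL _ h', rfl⟩
      | appR _ h =>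
        obtain ⟨s', h', rfl⟩ := ihs h
        exact ⟨_, BetaStep.appR _ h', rfl⟩
  | lam t ih =>
    cases h with
    | lam h =>
      obtain ⟨s', h', rfl⟩ := ih h
      exact ⟨_, BetaStep.lam h', rfl⟩

/-- The term `λx.(t)x` with `x` not free in `t`. -/
def etaExp (t : Lam) : Lam := lam (app (rename Nat.succ t) (var 0))

theorem BetaRed.etaExp {t s : Lam} (h : BetaRed t s) : BetaRed t.etaExp s.etaExp :=
  BetaRed.lam (BetaRed.app (h.rename _) ReflTransGen.refl)

/-- The overlap of the two reductions: expanding an abstraction creates a beta-redex that undoes the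
expansion. -/
theorem betaStep_etaExp_lam (t : Lam) : BetaStep (etaExp (lam t)) (lam t) := by
  have h := BetaStep.lam (BetaStep.beta (rename (upRen Nat.succ) t) (var 0))
  rwa [subst_single_upRen_succ] at h

theorem betaStep_app_etaExp (t s : Lam) : BetaStep (app (etaExp t) s) (app t s) := by
  have h := BetaStep.beta (app (rename Nat.succ t) (var 0)) s
  rwa [subst, subst_single_rename_succ] at h

/-! ### Normal terms -/

theorem isNormal_var (n : ℕ) : IsNormal (var n) := fun _ h => nomatch h

theorem isNormal_lam {t : Lam} : IsNormal (lam t) ↔ IsNormal t :=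
  ⟨fun h _ hs => h _ (BetaStep.lam hs), fun h _ hs => by cases hs with | lam hs => exact h _ hs⟩

theorem isNormal_app {t s : Lam} :
    IsNormal (app t s) ↔ (∀ p, t ≠ lam p) ∧ IsNormal t ∧ IsNormal s := by
  refine ⟨fun h => ⟨?_, fun _ hs => h _ (BetaStep.appL _ hs), fun _ hs => h _ (BetaStep.appR _ hs)⟩,
    fun ⟨h₁, h₂, h₃⟩ _ hs => ?_⟩
  · rintro p rfl
    exact h _ (BetaStep.beta _ _)
  · cases hs with
    | beta => exact h₁ _ rfl
    | appL _ h => exact h₂ _ h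
    | appR _ h => exact h₃ _ h

theorem IsNormal.rename {t : Lam} (h : IsNormal t) (ρ : ℕ → ℕ) : IsNormal (t.rename ρ) := by
  intro w hw
  obtain ⟨s, hs, -⟩ := hw.exists_of_rename
  exact h s hs

theorem IsNormal.eq_of_betaRed {t s : Lam} (h : IsNormal t) (hs : BetaRed t s) : t = s := by
  rcases ReflTransGen.cases_head hs with e | ⟨u, hu, -⟩
  · exact e
  · exact (h u hu).elim

theorem IsNormal.etaExp {t : Lam} (h : IsNormal t) (hl : ∀ p, t ≠ Lam.lam p) :
    IsNormal t.etaExp := by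
  refine isNormal_lam.2 (isNormal_app.2 ⟨fun p hp => ?_, h.rename _, isNormal_var 0⟩)
  cases t with
  | var n => cases hp
  | app t s => cases hp
  | lam t => exact hl t rfl

theorem Normalizable.etaExp {t : Lam} (h : Normalizable t) : Normalizable t.etaExp := by
  obtain ⟨n, hn, hN⟩ := h
  by_cases hl : ∃ p, n = Lam.lam p
  · obtain ⟨p, rfl⟩ := hl
    exact ⟨_, hn.etaExp.tail (betaStep_etaExp_lam p), hN⟩
  · exact ⟨_, hn.etaExp, hN.etaExp (not_exists.1 hl)⟩

/-! ### Confluence of beta-reduction -/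

/-- Parallel beta-reduction. -/
inductive BetaPar : Lam → Lam → Prop
  | var (n : ℕ) : BetaPar (var n) (var n)
  | app {t t' s s' : Lam} : BetaPar t t' → BetaPar s s' → BetaPar (app t s) (app t' s')
  | lam {t t' : Lam} : BetaPar t t' → BetaPar (lam t) (lam t')
  | beta {t t' s s' : Lam} : BetaPar t t' → BetaPar s s' →
      BetaPar (app (lam t) s) (subst (single s') t')

theorem BetaPar.refl (t : Lam) : BetaPar t t := by
  induction t with
  | var n => exact .var n
  | app _ _ iht ihs => exact .app iht ihs
  | lam _ ih => exact .lam ih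

theorem BetaStep.betaPar {t s : Lam} (h : BetaStep t s) : BetaPar t s := by
  induction h with
  | beta t s => exact .beta (.refl t) (.refl s)
  | appL s _ ih => exact .app ih (.refl s)
  | appR t _ ih => exact .app (.refl t) ih
  | lam _ ih => exact .lam ih

theorem BetaPar.betaRed {t s : Lam} (h : BetaPar t s) : BetaRed t s := by
  induction h with
  | var n => exact ReflTransGen.refl
  | app _ _ iht ihs => exact iht.app ihs
  | lam _ ih => exact ih.lam
  | beta _ _ iht ihs => exact (iht.lam.app ihs).tail (BetaStep.beta _ _)

theorem BetaPar.rename {t s : Lam} (h : BetaPar t s) (ρ : ℕ → ℕ) :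
    BetaPar (t.rename ρ) (s.rename ρ) := by
  induction h generalizing ρ with
  | var n => exact .var _
  | app _ _ iht ihs => exact .app (iht ρ) (ihs ρ)
  | lam _ ih => exact .lam (ih _)
  | beta _ _ iht ihs => rw [rename_subst_single]; exact .beta (iht _) (ihs ρ)

theorem BetaPar.subst {t s : Lam} (h : BetaPar t s) {σ τ : ℕ → Lam}
    (hσ : ∀ n, BetaPar (σ n) (τ n)) : BetaPar (t.subst σ) (s.subst τ) := by
  have up : ∀ {σ τ : ℕ → Lam}, (∀ n, BetaPar (σ n) (τ n)) →
      ∀ n, BetaPar (upSubst σ n) (upSubst τ n) := by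
    intro σ τ hσ n
    cases n with
    | zero => exact .var 0
    | succ n => exact (hσ n).rename _
  induction h generalizing σ τ with
  | var n => exact hσ n
  | app _ _ iht ihs => exact .app (iht hσ) (ihs hσ)
  | lam _ ih => exact .lam (ih (up hσ))
  | beta _ _ iht ihs => rw [subst_subst_single]; exact .beta (iht (up hσ)) (ihs hσ)

theorem BetaPar.subst_single {t t' s s' : Lam} (ht : BetaPar t t') (hs : BetaPar s s') :
    BetaPar (t.subst (single s)) (t'.subst (single s')) := by
  refine ht.subst fun n => ?_
  cases n with
  | zero => exact hs
  | succ n => exact .var n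

/-- The complete development of a term: all its beta-redexes are contracted at once. -/
def develop : Lam → Lam
  | var n => var n
  | lam t => lam (develop t)
  | app (lam t) s => subst (single (develop s)) (develop t)
  | app (var n) s => app (var n) (develop s)
  | app (app t u) s => app (develop (app t u)) (develop s)

/-- Triangle property: the target depends on `t` alone, so it joins any two parallel reducts of `t`.
-/
theorem BetaPar.develop {t s : Lam} (h : BetaPar t s) : BetaPar s t.develop := by
  induction h with
  | var n => exact .var n
  | @app t t' s s' ht _ iht ihs =>
    cases t with
    | var n => cases ht; exact .app (.var n) ihs
    | app t u => exact .app iht ihs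
    | lam t =>
      cases ht with
      | lam ht =>
        cases iht with
        | lam iht => exact .beta iht ihs
  | lam _ ih => exact .lam ih
  | beta _ _ iht ihs => exact iht.subst_single ihs

theorem BetaRed.confluent {t s u : Lam} (hs : BetaRed t s) (hu : BetaRed t u) :
    ∃ v, BetaRed s v ∧ BetaRed u v := by
  have par : ∀ {a b : Lam}, BetaRed a b → ReflTransGen BetaPar a b := fun h =>
    ReflTransGen.mono (fun _ _ h => h.betaPar) _ _ h
  have red : ∀ {a b : Lam}, ReflTransGen BetaPar a b → BetaRed a b := fun h => by
    induction h with
    | refl => exact ReflTransGen.refl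
    | tail _ h ih => exact ih.trans h.betaRed
  -- Parallel and one-step reduction have the same reflexive transitive closure, and the former has
  -- the diamond property.
  obtain ⟨v, h₁, h₂⟩ := church_rosser (r := BetaPar)
    (fun a b c hb hc => ⟨a.develop, ReflGen.single hb.develop, ReflTransGen.single hc.develop⟩)
    (par hs) (par hu)
  exact ⟨v, red h₁, red h₂⟩

/-! ### Parallel eta-reduction -/

/-- Parallel eta-reduction. -/
inductive EtaPar : Lam → Lam → Prop
  | var (n : ℕ) : EtaPar (var n) (var n)
  | app {t t' s s' : Lam} : EtaPar t t' → EtaPar s s' → EtaPar (app t s) (app t' s')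
  | lam {t t' : Lam} : EtaPar t t' → EtaPar (lam t) (lam t')
  | eta {t t' : Lam} : EtaPar t t' → EtaPar (etaExp t) t'

theorem EtaPar.refl (t : Lam) : EtaPar t t := by
  induction t with
  | var n => exact .var n
  | app _ _ iht ihs => exact .app iht ihs
  | lam _ ih => exact .lam ih

theorem EtaStep.etaPar {t s : Lam} (h : EtaStep t s) : EtaPar t s := by
  induction h with
  | eta t => exact .eta (.refl t)
  | appL s _ ih => exact .app ih (.refl s)
  | appR t _ ih => exact .app (.refl t) ih
  | lam _ ih => exact .lam ih

theorem rename_etaExp (ρ : ℕ → ℕ) (t : Lam) : t.etaExp.rename ρ = (t.rename ρ).etaExp := by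
  simp only [etaExp, rename, rename_upRen_succ]; rfl

theorem subst_etaExp (σ : ℕ → Lam) (t : Lam) : t.etaExp.subst σ = (t.subst σ).etaExp := by
  simp only [etaExp, subst, subst_upSubst_succ]; rfl

theorem EtaPar.rename {t s : Lam} (h : EtaPar t s) (ρ : ℕ → ℕ) :
    EtaPar (t.rename ρ) (s.rename ρ) := by
  induction h generalizing ρ with
  | var n => exact .var _
  | app _ _ iht ihs => exact .app (iht ρ) (ihs ρ)
  | lam _ ih => exact .lam (ih _)
  | eta _ ih => rw [rename_etaExp]; exact .eta (ih ρ)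

theorem EtaPar.subst {t s : Lam} (h : EtaPar t s) {σ τ : ℕ → Lam}
    (hσ : ∀ n, EtaPar (σ n) (τ n)) : EtaPar (t.subst σ) (s.subst τ) := by
  induction h generalizing σ τ with
  | var n => exact hσ n
  | app _ _ iht ihs => exact .app (iht hσ) (ihs hσ)
  | lam _ ih =>
    refine .lam (ih fun n => ?_)
    cases n with
    | zero => exact .var 0
    | succ n => exact (hσ n).rename _
  | eta _ ih => rw [subst_etaExp]; exact .eta (ih hσ)

theorem EtaPar.subst_single {t t' s s' : Lam} (ht : EtaPar t t') (hs : EtaPar s s') :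
    EtaPar (t.subst (single s)) (t'.subst (single s')) := by
  refine ht.subst fun n => ?_
  cases n with
  | zero => exact hs
  | succ n => exact .var n

theorem freeVars_etaExp (t : Lam) : freeVars t.etaExp = freeVars t := by
  ext m
  constructor
  · rintro (h | h)
    · obtain ⟨n, hn, e⟩ := mem_freeVars_rename.1 h
      exact Nat.succ_injective e ▸ hn
    · cases h
  · exact fun h => Or.inl (mem_freeVars_rename.2 ⟨m, h, rfl⟩)

/-- Unlike beta, eta erases no variable; this lets bounds on free variables pass in both directions.
-/
theorem EtaPar.freeVars_eq {t s : Lam} (h : EtaPar t s) : freeVars t = freeVars s := by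
  induction h with
  | var n => rfl
  | app _ _ iht ihs => simp only [freeVars, iht, ihs]
  | lam _ ih => simp only [freeVars, ih]
  | eta _ ih => rw [freeVars_etaExp, ih]

theorem EtaPar.exists_lam {t p : Lam} (h : EtaPar t (Lam.lam p)) : ∃ q, t = Lam.lam q := by
  cases h with
  | lam => exact ⟨_, rfl⟩
  | eta => exact ⟨_, rfl⟩

/-- An abstraction arises only from an abstraction (`EtaPar.exists_lam`), so a redex at the root of
the result was already one in the source. -/
theorem EtaPar.isNormal {t s : Lam} (h : EtaPar t s) (ht : IsNormal t) : IsNormal s := by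
  induction h with
  | var n => exact ht
  | app h _ iht ihs =>
    obtain ⟨h₁, h₂, h₃⟩ := isNormal_app.1 ht
    refine isNormal_app.2 ⟨?_, iht h₂, ihs h₃⟩
    rintro p rfl
    obtain ⟨q, rfl⟩ := h.exists_lam
    exact h₁ q rfl
  | lam _ ih => exact isNormal_lam.2 (ih (isNormal_lam.1 ht))
  | eta _ ih =>
    exact ih fun s hs => ht _ (BetaStep.lam (BetaStep.appL _ (hs.rename _)))

/-- Beta-reduction commutes with parallel eta-reduction. -/
theorem EtaPar.commute_step {t s u : Lam} (h : EtaPar t s) (hu : BetaStep t u) :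
    ∃ v, BetaRed s v ∧ EtaPar u v := by
  induction h generalizing u with
  | var n => cases hu
  | @app t t' s s' h₁ h₂ iht ihs =>
    cases hu with
    | beta q =>
      generalize e : Lam.lam q = x at h₁
      cases h₁ with
      | var => cases e
      | app => cases e
      | lam h => cases e; exact ⟨_, ReflTransGen.single (.beta _ _), h.subst_single h₂⟩
      -- The function is an eta-redex: firing the beta-redex merely removes the expansion, so the
      -- other side need not move.
      | eta h =>
        cases e
        refine ⟨_, ReflTransGen.refl, ?_⟩
        rw [Lam.subst, subst_single_rename_succ]
        exact .app h h₂
    | appL _ hu =>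
      obtain ⟨v, hv, hv'⟩ := iht hu
      exact ⟨_, hv.app ReflTransGen.refl, .app hv' h₂⟩
    | appR _ hu =>
      obtain ⟨v, hv, hv'⟩ := ihs hu
      exact ⟨_, BetaRed.app ReflTransGen.refl hv, .app h₁ hv'⟩
  | lam _ ih =>
    cases hu with
    | lam hu =>
      obtain ⟨v, hv, hv'⟩ := ih hu
      exact ⟨_, hv.lam, .lam hv'⟩
  | @eta t t' h ih =>
    cases hu with
    | lam hu =>
      generalize e : Lam.rename Nat.succ t = x at hu
      cases hu with
      -- The body of the expansion is a beta-redex: contracting it gives back the expanded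
      -- abstraction.
      | beta q =>
        cases t with
        | var => cases e
        | app => cases e
        | lam t =>
          cases e
          refine ⟨_, ReflTransGen.refl, ?_⟩
          rwa [subst_single_upRen_succ]
      | appL _ hu =>
        subst e
        obtain ⟨u', hu', rfl⟩ := hu.exists_of_rename
        obtain ⟨v, hv, hv'⟩ := ih hu'
        exact ⟨v, hv, .eta hv'⟩
      | appR _ hu => cases hu

theorem EtaPar.commute {t s u : Lam} (h : EtaPar t s) (hu : BetaRed t u) :
    ∃ v, BetaRed s v ∧ EtaPar u v := by
  induction hu with
  | refl => exact ⟨s, ReflTransGen.refl, h⟩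
  | tail _ hu ih =>
    obtain ⟨v, hv, hv'⟩ := ih
    obtain ⟨w, hw, hw'⟩ := hv'.commute_step hu
    exact ⟨w, hv.trans hw, hw'⟩

/-- Such a `t` is an abstraction under finitely many eta-expansions, which beta-steps strip off. -/
theorem EtaPar.exists_betaRed_lam {t p : Lam} (h : EtaPar t (Lam.lam p)) :
    ∃ q, BetaRed t (Lam.lam q) ∧ EtaPar q p := by
  generalize e : Lam.lam p = s at h
  induction h with
  | var => cases e
  | app => cases e
  | lam h => cases e; exact ⟨_, ReflTransGen.refl, h⟩
  | eta _ ih =>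
    obtain ⟨q, hq, hqp⟩ := ih e
    exact ⟨q, hq.etaExp.tail (betaStep_etaExp_lam q), hqp⟩

/-- Eta-reduction can be postponed after beta-reduction. -/
theorem EtaPar.postpone_step {t s u : Lam} (h : EtaPar t s) (hu : BetaStep s u) :
    ∃ v, BetaRed t v ∧ EtaPar v u := by
  induction h generalizing u with
  | var n => cases hu
  | app h₁ h₂ iht ihs =>
    cases hu with
    | beta p =>
      obtain ⟨q, hq, hqp⟩ := h₁.exists_betaRed_lam
      exact ⟨_, (hq.app ReflTransGen.refl).tail (.beta _ _), hqp.subst_single h₂⟩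
    | appL _ hu =>
      obtain ⟨v, hv, hv'⟩ := iht hu
      exact ⟨_, hv.app ReflTransGen.refl, .app hv' h₂⟩
    | appR _ hu =>
      obtain ⟨v, hv, hv'⟩ := ihs hu
      exact ⟨_, BetaRed.app ReflTransGen.refl hv, .app h₁ hv'⟩
  | lam _ ih =>
    cases hu with
    | lam hu =>
      obtain ⟨v, hv, hv'⟩ := ih hu
      exact ⟨_, hv.lam, .lam hv'⟩
  | eta _ ih =>
    obtain ⟨v, hv, hv'⟩ := ih hu
    exact ⟨_, hv.etaExp, .eta hv'⟩

theorem EtaPar.postpone {t s u : Lam} (h : EtaPar t s) (hu : BetaRed s u) :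
    ∃ v, BetaRed t v ∧ EtaPar v u := by
  induction hu with
  | refl => exact ⟨t, ReflTransGen.refl, h⟩
  | tail _ hu ih =>
    obtain ⟨v, hv, hv'⟩ := ih
    obtain ⟨w, hw, hw'⟩ := hv'.postpone_step hu
    exact ⟨w, hv.trans hw, hw'⟩

/-- A term that eta-reduces to a normal term is normalizable; if the latter is no abstraction,
then its normal form is no abstraction either, or an eta-expansion of such a term. -/
theorem EtaPar.normalizable_aux {t n : Lam} (h : EtaPar t n) (hn : IsNormal n) :
    Normalizable t ∧ ((∀ p, n ≠ Lam.lam p) → ∃ m, IsNormal m ∧ (∀ p, m ≠ Lam.lam p) ∧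
      (BetaRed t m ∨ BetaRed t m.etaExp)) := by
  induction h with
  | var n =>
    exact ⟨⟨_, ReflTransGen.refl, hn⟩, fun h => ⟨_, hn, h, Or.inl ReflTransGen.refl⟩⟩
  | @app t t' s s' _ _ iht ihs =>
    obtain ⟨h₁, h₂, h₃⟩ := isNormal_app.1 hn
    -- The second half of the statement is needed here: a function part known only to be
    -- normalizable could form a new redex with its argument.
    obtain ⟨m, hm, hl, hr⟩ := (iht h₂).2 h₁
    obtain ⟨k, hk, hK⟩ := (ihs h₃).1
    have hmk : IsNormal (Lam.app m k) := isNormal_app.2 ⟨hl, hm, hK⟩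
    have hred : BetaRed (Lam.app t s) (Lam.app m k) := by
      rcases hr with hr | hr
      · exact hr.app hk
      · exact (hr.app hk).tail (betaStep_app_etaExp m k)
    exact ⟨⟨_, hred, hmk⟩, fun _ => ⟨_, hmk, fun p hp => by (cases hp), Or.inl hred⟩⟩
  | lam _ ih =>
    obtain ⟨k, hk, hK⟩ := (ih (isNormal_lam.1 hn)).1
    exact ⟨⟨_, hk.lam, isNormal_lam.2 hK⟩, fun h => (h _ rfl).elim⟩
  | eta _ ih =>
    refine ⟨(ih hn).1.etaExp, fun h => ?_⟩
    obtain ⟨m, hm, hl, hr⟩ := (ih hn).2 h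
    refine ⟨m, hm, hl, Or.inr ?_⟩
    rcases hr with hr | hr
    · exact hr.etaExp
    -- An expansion is an abstraction, so two nested expansions collapse to one.
    · exact hr.etaExp.tail (betaStep_etaExp_lam _)

end Lam

/-! ### The set of the terms with a normal form over given variables -/

open Lam Relation

/-- The terms that reduce to a normal term with free variables in `V`. -/
def normalizingIn (V : Set ℕ) : Set Lam :=
  {t | ∃ n, BetaRed t n ∧ IsNormal n ∧ freeVars n ⊆ V}

theorem mem_normalizingIn_iff_of_betaStep {V : Set ℕ} {t s : Lam} (h : BetaStep t s) :
    t ∈ normalizingIn V ↔ s ∈ normalizingIn V := by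
  constructor
  -- A common reduct of `n` and `s` can only be `n` itself.
  · rintro ⟨n, hn, hN, hV⟩
    obtain ⟨v, h₁, h₂⟩ := hn.confluent (ReflTransGen.single h)
    exact ⟨n, hN.eq_of_betaRed h₁ ▸ h₂, hN, hV⟩
  · rintro ⟨n, hn, hN, hV⟩
    exact ⟨n, hn.head h, hN, hV⟩

theorem mem_normalizingIn_iff_of_etaPar {V : Set ℕ} {t s : Lam} (h : EtaPar t s) :
    t ∈ normalizingIn V ↔ s ∈ normalizingIn V := by
  constructor
  · rintro ⟨n, hn, hN, hV⟩
    obtain ⟨v, h₁, h₂⟩ := h.commute hn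
    exact ⟨v, h₁, h₂.isNormal hN, h₂.freeVars_eq ▸ hV⟩
  · rintro ⟨n, hn, hN, hV⟩
    obtain ⟨v, h₁, h₂⟩ := h.postpone hn
    obtain ⟨m, hm, hM⟩ := (h₂.normalizable_aux hN).1
    exact ⟨m, h₁.trans hm, hM, hm.freeVars_subset.trans (h₂.freeVars_eq ▸ hV)⟩

theorem saturated_normalizingIn (V : Set ℕ) : Saturated (normalizingIn V) := by
  intro t s hs h
  -- An equivalence is proved so that the induction passes through the symmetry rule.
  refine Iff.mpr ?_ hs
  clear hs
  induction h with
  | rel t s h =>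
    rcases h with h | h
    · exact mem_normalizingIn_iff_of_betaStep h
    · exact mem_normalizingIn_iff_of_etaPar h.etaPar
  | refl => exact Iff.rfl
  | symm _ _ _ ih => exact ih.symm
  | trans _ _ _ _ _ ih₁ ih₂ => exact ih₁.trans ih₂

/-- A term belongs to `normalizingIn V` as soon as its application to a fresh variable does. -/
theorem mem_normalizingIn_of_app_var {V : Set ℕ} {t : Lam} {x : ℕ} (hx : x ∉ freeVars t)
    (h : app t (var x) ∈ normalizingIn V) : t ∈ normalizingIn V := by
  obtain ⟨n, hn, hN, hV⟩ := h
  refine (mem_normalizingIn_iff_of_etaPar (EtaPar.eta (EtaPar.refl t))).1 ?_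
  -- This renaming prepares the abstraction over `x`: it turns `(t)x` into the body of `etaExp t`,
  -- and the abstraction then removes `x` from the free variables.
  let ρ : ℕ → ℕ := fun k => if k = x then 0 else k + 1
  have e : rename ρ (app t (var x)) = app (rename Nat.succ t) (var 0) := by
    have h₁ : rename ρ t = rename Nat.succ t :=
      rename_congr fun k hk => if_neg (ne_of_mem_of_not_mem hk hx)
    have h₂ : ρ x = 0 := if_pos rfl
    rw [rename, rename, h₁, h₂]
  refine ⟨lam (rename ρ n), BetaRed.lam (e ▸ hn.rename ρ), isNormal_lam.2 (hN.rename ρ), ?_⟩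
  intro m hm
  obtain ⟨k, hk, hkm⟩ := mem_freeVars_rename.1 hm
  by_cases hkx : k = x
  · simp [ρ, hkx] at hkm
  · have : k = m := by simpa [ρ, hkx] using hkm
    exact this ▸ hV hk

/-- The terms `(x)u₁…uₙ` with `x ∈ V` and all `uᵢ` in `normalizingIn V`. -/
inductive NeutralIn (V : Set ℕ) : Lam → Prop
  | var {x : ℕ} : x ∈ V → NeutralIn V (var x)
  | app {t s : Lam} : NeutralIn V t → s ∈ normalizingIn V → NeutralIn V (app t s)

theorem NeutralIn.mem_normalizingIn {V : Set ℕ} {t : Lam} (h : NeutralIn V t) :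
    t ∈ normalizingIn V := by
  -- The induction must also know that the normal form is no abstraction, so that applying it
  -- creates no redex.
  suffices ∃ n, BetaRed t n ∧ (IsNormal n ∧ freeVars n ⊆ V) ∧ ∀ p, n ≠ lam p by
    obtain ⟨n, h₁, ⟨h₂, h₃⟩, -⟩ := this
    exact ⟨n, h₁, h₂, h₃⟩
  induction h with
  | @var x hx =>
    exact ⟨_, ReflTransGen.refl, ⟨isNormal_var x, Set.singleton_subset_iff.2 hx⟩,
      fun p hp => by cases hp⟩
  | app _ hs ih =>
    obtain ⟨n, h₁, ⟨h₂, h₃⟩, h₄⟩ := ih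
    obtain ⟨k, hk, hK, hV⟩ := hs
    exact ⟨_, h₁.app hk, ⟨isNormal_app.2 ⟨h₄, h₂, hK⟩, Set.union_subset h₃ hV⟩,
      fun p hp => by cases hp⟩

/-! ### The model of all saturated sets over a one-element base -/

theorem BetaEtaEq.app_right {t s : Lam} (h : BetaEtaEq t s) (u : Lam) :
    BetaEtaEq (app t u) (app s u) := by
  induction h with
  | rel _ _ h => exact .rel _ _ (h.imp (BetaStep.appL u) (EtaStep.appL u))
  | refl => exact .refl _
  | symm _ _ _ ih => exact .symm _ _ ih
  | trans _ _ _ _ _ ih₁ ih₂ => exact .trans _ _ _ ih₁ ih₂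

/-- For arrows, saturation of the target is enough, since equivalence is compatible with application
to a fixed argument. -/
theorem adequate_saturated : Adequate {G | Saturated G} where
  saturated _ hG := hG
  arrow_mem _ _ _ hG' _ _ hs h u hu := hG' _ _ (hs u hu) (BetaEtaEq.app_right h u)
  sInter_mem _ hσ _ _ hs h G hG := hσ hG _ _ (hs G hG) h

/-- The model over a one-element base whose truth values are all the saturated sets, and where
every relation symbol is interpreted by the saturated set `G`. -/
def saturatedModel (L : FirstOrder.Language.{u, v}) (G : Set Lam) (hG : Saturated G) :
    Model.{u, v, w} L where
  base := PUnit
  base_nonempty := ⟨PUnit.unit⟩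
  truth := {G | Saturated G}
  adequate := adequate_saturated
  fn _ _ := PUnit.unit
  rel _ _ := ⟨G, hG⟩

/-- If all free relation variables of `A` are interpreted by `normalizingIn V`, then the value of
`A` is included in it for positive `A`, and contains the neutral terms for negative `A`. -/
theorem value_saturatedModel {L : FirstOrder.Language.{u, v}} {V : Set ℕ} (hV : Vᶜ.Finite)
    (A : Formula L)
    (I : (saturatedModel.{u, v, w} L _ (saturated_normalizingIn V)).Interp)
    (hI : ∀ X ∈ A.freeRel, ∀ a, (I.rel X a : Set Lam) = normalizingIn V) :
    (A.IsPos → Model.value _ I A ⊆ normalizingIn V) ∧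
      (A.IsNeg → {t | NeutralIn V t} ⊆ Model.value _ I A) := by
  induction A generalizing I with
  | relVar X ts =>
    have e : Model.value _ I (.relVar X ts) = normalizingIn V := hI X rfl _
    exact ⟨fun _ => e.subset, fun _ t ht => e.symm.subset ht.mem_normalizingIn⟩
  | relSym P ts =>
    exact ⟨fun _ => subset_rfl, fun _ t ht => ht.mem_normalizingIn⟩
  | imp B A ihB ihA =>
    have ihB := ihB I fun X hX => hI X (Or.inl hX)
    have ihA := ihA I fun X hX => hI X (Or.inr hX)
    constructor
    · rintro ⟨⟩ t ht
      rename_i hB hA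
      -- Cofiniteness of `V` provides a variable of `V` not free in `t`; being neutral, it lies in
      -- the value of `B`.
      obtain ⟨x, hx⟩ := (hV.union t.finite_freeVars).exists_notMem
      have hxV : x ∈ V := not_not.1 fun h => hx (Or.inl h)
      exact mem_normalizingIn_of_app_var (fun h => hx (Or.inr h))
        (ihA.1 hA (ht _ (ihB.2 hB (NeutralIn.var hxV))))
    · rintro ⟨⟩ t ht s hs
      rename_i hB hA
      exact ihA.2 hA (NeutralIn.app ht (ihB.1 hB hs))
  | allInd x A ih =>
    constructor
    · rintro ⟨⟩ t ht
      rename_i hA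
      exact (ih (I.setInd x PUnit.unit) hI).1 hA (Set.mem_iInter.1 ht _)
    · rintro ⟨⟩ t ht
      rename_i hA
      exact Set.mem_iInter.2 fun a => (ih (I.setInd x a) hI).2 hA ht
  | allRel X A ih =>
    constructor
    · rintro ⟨⟩ t ht
      rename_i hA
      -- Among all instances of the quantifier, this one keeps the hypothesis on free relation
      -- variables.
      refine (ih (I.setRel X fun _ => ⟨_, saturated_normalizingIn V⟩) fun Y hY a => ?_).1 hA
        (Set.mem_iInter.1 ht _)
      by_cases hYX : Y = X
      · subst hYX
        simp [Model.Interp.setRel]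
      · simpa [Model.Interp.setRel, hYX] using hI Y ⟨hY, hYX⟩ a
    · rintro ⟨⟩ t ht
      rename_i hA hX
      -- Here `Φ` is arbitrary, but `X` is not free in the body, so the hypothesis still holds.
      refine Set.mem_iInter.2 fun Φ => (ih (I.setRel X Φ) fun Y hY a => ?_).2 hA ht
      have hYX : Y ≠ X := fun h => hX (h ▸ hY)
      simpa [Model.Interp.setRel, hYX] using hI Y ⟨hY, hYX⟩ a

end AF2

theorem mainTheorem5 {L : FirstOrder.Language.{u, v}} (E : Set (L.Term ℕ × L.Term ℕ))
    (A : AF2.Formula L) (hclosed : A.Closed) (hpos : A.IsPos) (t : AF2.Lam)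
    (ht : t ∈ AF2.betaEtaValue.{u, v, w} E A) :
    t.Normalizable ∧ ∃ s : AF2.Lam, s.Closed ∧ AF2.Lam.BetaEq t s := by
  -- Beta-reduction creates no free variables, so a normal form of `t` with variables in this
  -- complement is closed.
  have hsat := AF2.saturated_normalizingIn t.freeVarsᶜ
  let M := AF2.saturatedModel.{u, v, w} L _ hsat
  let I : M.Interp := ⟨fun _ => PUnit.unit, fun _ _ => ⟨_, hsat⟩⟩
  have hfin : t.freeVarsᶜᶜ.Finite := by rw [compl_compl]; exact t.finite_freeVars
  obtain ⟨n, hn, hN, hV⟩ := (AF2.value_saturatedModel hfin A I fun _ _ _ => rfl).1 hpos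
    (ht M (fun _ _ _ => rfl) I)
  exact ⟨⟨n, hn, hN⟩, n,
    Set.eq_empty_of_forall_notMem fun x hx => hV hx (AF2.Lam.BetaRed.freeVars_subset hn hx),
    Relation.EqvGen.reflTransGen_le_eqvGen _ _ _ hn⟩
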